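/- Let $q$ denote a complex number with $|q|<1$, and write $(a;q)_n=\prod_{j=0}^{n-1}(1-aq^j)$ and $(a;q)_\infty=\prod_{j=0}^{\infty}(1-aq^j)$. Let the numbers $C'(n)$, $n\ge 1$, be the coefficients of the generating function $$\sum_{n=1}^\infty C'(n)q^n:=\sum_{n=1}^\infty q^n(q^{n+1};q)_\infty^2\,(q^n;q)_\infty\,(q^n;q)_n\qquad(|q|<1).$$ (The products and series on the right converge for every $|q|<1$, and such coefficients exist and are integers.) Then, for every complex $q$ with $|q|<1$, all the series below converge and $$\sum_{n=1}^\infty C'(n)q^{8n+2}=2\sum_{r,n=0}^\infty(-1)^{n+1}q^{(2r+3)^2+(2r+3+2n)^2}+\sum_{n=0}^\infty(-1)^{n+1}q^{1+(2n+1)^2}+\sum_{n=0}^\infty q^{2(2n+1)^2}.$$ -/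

import Mathlib

/-- The finite `q`-shifted factorial `(a; q)_n = ∏_{j=0}^{n-1} (1 - a q^j)`. -/
noncomputable def qPoch (a q : ℂ) (n : ℕ) : ℂ :=
  ∏ j ∈ Finset.range n, (1 - a * q ^ j)

/-- The infinite `q`-shifted factorial `(a; q)_∞ = ∏_{j≥0} (1 - a q^j)`. -/
noncomputable def qPochInf (a q : ℂ) : ℂ :=
  ∏' j : ℕ, (1 - a * q ^ j)

/-- The summand `q^n (q^{n+1}; q)_∞^2 (q^n; q)_∞ (q^n; q)_n`. -/
noncomputable def cTerm (q : ℂ) (n : ℕ) : ℂ :=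
  q ^ n * qPochInf (q ^ (n + 1)) q ^ 2 * qPochInf (q ^ n) q * qPoch (q ^ n) q n

/-- `C` is the coefficient sequence of the generating function: for all complex `|q| < 1`,
`∑_{n≥1} C(n) q^n` converges to `∑_{n≥1} q^n (q^{n+1}; q)_∞^2 (q^n; q)_∞ (q^n; q)_n`.
The sums over `n ≥ 1` are written with `n + 1`, `n : ℕ`; the value `C 0` plays no role. -/
def IsCCoeff (C : ℕ → ℂ) : Prop :=
  ∀ q : ℂ, ‖q‖ < 1 →
    HasSum (fun n : ℕ => C (n + 1) * q ^ (n + 1)) (∑' n : ℕ, cTerm q (n + 1))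

/-! Put S(a) = `∑' n, squareTerm q a n` and L(b) = `∑' n, linearTerm q b n`. The generating function
is S(1), since its n = 0 term vanishes. A termwise identity makes S(a) + a S(aq) invariant under a ↦
aq; letting a q^k → 0 identifies the constant as L(q) (`tsum_squareTerm_add`). A telescoping sum
gives L(b) + b L(bq) = 1 (`tsum_linearTerm_add`). Both recurrences unroll into partial theta series
(`hasSum_partialTheta_of_recurrence`), so with F = `falseTheta q` the generating function is F(1 -
F) (`tsum_cTerm_succ_eq`).

Replace q by q^8 and multiply by q^2. With t_n = (-1)^n q^{(2n+1)^2} and T = ∑ t_n = q F(q^8), the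
result is qT - T^2. Writing T^2 + ∑ t_n^2 as twice the sum of t_m t_n over m ≤ n, and splitting off
m = 0, yields the three series (`two_squares_sum_eq`). -/

open Filter Topology

/-! ### Bounds and limits for q-shifted factorials -/

section Products

variable {q : ℂ}

lemma hasSum_norm_mul_pow (hq : ‖q‖ < 1) (z : ℂ) :
    HasSum (fun j : ℕ => ‖-(z * q ^ j)‖) (‖z‖ / (1 - ‖q‖)) := by
  simpa [div_eq_mul_inv] using (hasSum_geometric_of_lt_one (norm_nonneg q) hq).mul_left ‖z‖

lemma multipliable_qPochInf (hq : ‖q‖ < 1) (z : ℂ) :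
    Multipliable (fun j : ℕ => 1 - z * q ^ j) := by
  simpa [sub_eq_add_neg] using multipliable_one_add_of_summable (hasSum_norm_mul_pow hq z).summable

lemma qPochInf_eq_mul (hq : ‖q‖ < 1) (z : ℂ) :
    qPochInf z q = (1 - z) * qPochInf (z * q) q := by
  have h : Multipliable (fun j : ℕ => 1 - z * q ^ (j + 1)) := by
    simpa [pow_succ', mul_assoc] using multipliable_qPochInf hq (z * q)
  have h2 := tprod_eq_zero_mul' (f := fun j : ℕ => 1 - z * q ^ j) h
  rw [pow_zero, mul_one] at h2
  refine h2.trans (congrArg _ (tprod_congr fun j => ?_))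
  rw [pow_succ', mul_assoc]

lemma norm_qPoch_sub_one_le (hq : ‖q‖ < 1) (z : ℂ) (n : ℕ) :
    ‖qPoch z q n - 1‖ ≤ Real.exp (‖z‖ / (1 - ‖q‖)) - 1 := by
  have h := Finset.norm_prod_one_add_sub_one_le (Finset.range n) (fun j => -(z * q ^ j))
  have h2 := (hasSum_norm_mul_pow hq z).summable.sum_le_tsum (Finset.range n)
    (fun _ _ => norm_nonneg _)
  rw [(hasSum_norm_mul_pow hq z).tsum_eq] at h2
  simp only [qPoch, sub_eq_add_neg (1 : ℂ)]
  exact h.trans (sub_le_sub_right (Real.exp_le_exp.2 h2) 1)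

lemma tendsto_qPoch (hq : ‖q‖ < 1) (z : ℂ) :
    Tendsto (qPoch z q) atTop (𝓝 (qPochInf z q)) :=
  (multipliable_qPochInf hq z).hasProd.tendsto_prod_nat

lemma norm_qPochInf_sub_one_le (hq : ‖q‖ < 1) (z : ℂ) :
    ‖qPochInf z q - 1‖ ≤ Real.exp (‖z‖ / (1 - ‖q‖)) - 1 :=
  le_of_tendsto ((tendsto_qPoch hq z).sub_const 1).norm
    (Eventually.of_forall fun n => norm_qPoch_sub_one_le hq z n)

lemma norm_qPoch_le (hq : ‖q‖ < 1) {z : ℂ} (hz : ‖z‖ ≤ 1) (n : ℕ) :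
    ‖qPoch z q n‖ ≤ Real.exp (1 / (1 - ‖q‖)) := by
  have h := norm_qPoch_sub_one_le hq z n
  have h2 := norm_add_le (qPoch z q n - 1) 1
  have h3 : Real.exp (‖z‖ / (1 - ‖q‖)) ≤ Real.exp (1 / (1 - ‖q‖)) :=
    Real.exp_le_exp.2 (div_le_div_of_nonneg_right hz (by linarith))
  simp only [sub_add_cancel, norm_one] at h2
  linarith

lemma norm_qPochInf_le (hq : ‖q‖ < 1) {z : ℂ} (hz : ‖z‖ ≤ 1) :
    ‖qPochInf z q‖ ≤ Real.exp (1 / (1 - ‖q‖)) :=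
  le_of_tendsto (tendsto_qPoch hq z).norm
    (Eventually.of_forall fun n => norm_qPoch_le hq hz n)

lemma tendsto_exp_norm_div_sub_one (q : ℂ) {z : ℕ → ℂ} (hz : Tendsto z atTop (𝓝 0)) :
    Tendsto (fun k => Real.exp (‖z k‖ / (1 - ‖q‖)) - 1) atTop (𝓝 0) := by
  have h : Continuous (fun w : ℂ => Real.exp (‖w‖ / (1 - ‖q‖)) - 1) := by fun_prop
  simpa [Function.comp_def] using (h.tendsto 0).comp hz

lemma tendsto_qPochInf_one (hq : ‖q‖ < 1) {z : ℕ → ℂ} (hz : Tendsto z atTop (𝓝 0)) :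
    Tendsto (fun k => qPochInf (z k) q) atTop (𝓝 1) :=
  tendsto_iff_norm_sub_tendsto_zero.2 <|
    squeeze_zero (fun _ => norm_nonneg _) (fun k => norm_qPochInf_sub_one_le hq (z k))
      (tendsto_exp_norm_div_sub_one q hz)

lemma tendsto_qPoch_one (hq : ‖q‖ < 1) {z : ℕ → ℂ} (hz : Tendsto z atTop (𝓝 0)) (n : ℕ) :
    Tendsto (fun k => qPoch (z k) q n) atTop (𝓝 1) :=
  tendsto_iff_norm_sub_tendsto_zero.2 <|
    squeeze_zero (fun _ => norm_nonneg _) (fun k => norm_qPoch_sub_one_le hq (z k) n)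
      (tendsto_exp_norm_div_sub_one q hz)

lemma qPoch_succ (z : ℂ) (n : ℕ) : qPoch z q (n + 1) = qPoch z q n * (1 - z * q ^ n) :=
  Finset.prod_range_succ _ _

lemma qPoch_succ' (z : ℂ) (n : ℕ) : qPoch z q (n + 1) = (1 - z) * qPoch (z * q) q n := by
  simp only [qPoch, Finset.prod_range_succ', pow_zero, mul_one, pow_succ']
  rw [mul_comm]
  simp [mul_assoc]

lemma qPochInf_one_left (hq : ‖q‖ < 1) : qPochInf 1 q = 0 := by
  rw [qPochInf_eq_mul hq]; simp

end Products

/-! ### Partial theta series from a first-order q-recurrence -/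

section PartialTheta

variable {q : ℂ}

lemma sub_one_le_choose_two (n : ℕ) : n - 1 ≤ n.choose 2 := by
  rcases n with _ | n
  · simp
  · rw [Nat.choose_succ_succ' n 1, Nat.choose_one_right]; simp

lemma summable_norm_pow_of_sub_one_le (hq : ‖q‖ < 1) {e : ℕ → ℕ} (he : ∀ n, n - 1 ≤ e n) :
    Summable (fun n => ‖q‖ ^ e n) := by
  rw [← summable_nat_add_iff 1]
  exact (summable_geometric_of_lt_one (norm_nonneg q) hq).of_nonneg_of_le
    (fun n => by positivity)
    (fun n => pow_le_pow_of_le_one (norm_nonneg q) hq.le (he (n + 1)))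

/-- Iterating g(a) = c - a g(aq) produces the partial sums; boundedness of g on the unit disc kills
the remainder. -/
lemma hasSum_partialTheta_of_recurrence (hq : ‖q‖ < 1) {g : ℂ → ℂ} {c : ℂ} {M : ℝ}
    (hM : ∀ a, ‖a‖ ≤ 1 → ‖g a‖ ≤ M) (hg : ∀ a, ‖a‖ ≤ 1 → g a + a * g (a * q) = c)
    {a : ℂ} (ha : ‖a‖ ≤ 1) :
    HasSum (fun n : ℕ => c * ((-1) ^ n * a ^ n * q ^ n.choose 2)) (g a) := by
  have hnorm : ∀ n : ℕ, ‖a * q ^ n‖ ≤ 1 := fun n => by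
    rw [norm_mul, norm_pow]
    exact mul_le_one₀ ha (by positivity) (pow_le_one₀ (norm_nonneg q) hq.le)
  have hterm : ∀ n : ℕ, ‖(-1) ^ n * a ^ n * q ^ n.choose 2‖ ≤ ‖q‖ ^ n.choose 2 := fun n => by
    simp only [norm_mul, norm_pow, norm_neg, norm_one, one_pow, one_mul]
    exact mul_le_of_le_one_left (by positivity) (pow_le_one₀ (norm_nonneg a) ha)
  have hs := summable_norm_pow_of_sub_one_le hq sub_one_le_choose_two
  have hpart : ∀ N : ℕ, ∑ n ∈ Finset.range N, c * ((-1) ^ n * a ^ n * q ^ n.choose 2)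
      = g a - (-1) ^ N * a ^ N * q ^ N.choose 2 * g (a * q ^ N) := by
    intro N
    induction N with
    | zero => simp
    | succ N ih =>
      rw [Finset.sum_range_succ, ih, ← hg _ (hnorm N), Nat.choose_succ_succ' N 1,
        Nat.choose_one_right]
      ring_nf
  have hsum : Summable (fun n : ℕ => c * ((-1) ^ n * a ^ n * q ^ n.choose 2)) :=
    (Summable.of_norm_bounded hs hterm).mul_left c
  rw [hsum.hasSum_iff_tendsto_nat]
  simp only [hpart]
  have hz : Tendsto (fun N : ℕ => (-1) ^ N * a ^ N * q ^ N.choose 2 * g (a * q ^ N))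
      atTop (𝓝 0) := by
    refine squeeze_zero_norm (a := fun N => ‖q‖ ^ N.choose 2 * M) (fun N => ?_) ?_
    · rw [norm_mul]
      exact mul_le_mul (hterm N) (hM _ (hnorm N)) (norm_nonneg _) (by positivity)
    · simpa using hs.tendsto_atTop_zero.mul_const M
  simpa using hz.const_sub (g a)

end PartialTheta

/-! ### Recurrences for the sums of products -/

section ProductSums

variable {q : ℂ}

lemma norm_mul_pow_le_one (hq : ‖q‖ < 1) {a : ℂ} (ha : ‖a‖ ≤ 1) (n : ℕ) : ‖a * q ^ n‖ ≤ 1 := by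
  rw [norm_mul, norm_pow]
  exact mul_le_one₀ ha (by positivity) (pow_le_one₀ (norm_nonneg q) hq.le)

lemma norm_pow_le_one (hq : ‖q‖ < 1) (n : ℕ) : ‖q ^ n‖ ≤ 1 := by
  rw [norm_pow]; exact pow_le_one₀ (norm_nonneg q) hq.le

lemma tendsto_mul_pow_zero (hq : ‖q‖ < 1) (a : ℂ) :
    Tendsto (fun n : ℕ => a * q ^ n) atTop (𝓝 0) := by
  simpa using (tendsto_pow_atTop_nhds_zero_of_norm_lt_one hq).const_mul a

/-- The summand `q^n (q^{n+1}; q)_∞ (b q^n; q)_∞`. -/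
noncomputable def linearTerm (q b : ℂ) (n : ℕ) : ℂ :=
  q ^ n * qPochInf (q ^ (n + 1)) q * qPochInf (b * q ^ n) q

/-- The summand `q^n (q^{n+1}; q)_∞² (a q^n; q)_∞ (a q^n; q)_n`. -/
noncomputable def squareTerm (q a : ℂ) (n : ℕ) : ℂ :=
  q ^ n * qPochInf (q ^ (n + 1)) q ^ 2 * qPochInf (a * q ^ n) q * qPoch (a * q ^ n) q n

lemma norm_linearTerm_le (hq : ‖q‖ < 1) {b : ℂ} (hb : ‖b‖ ≤ 1) (n : ℕ) :
    ‖linearTerm q b n‖ ≤ ‖q‖ ^ n * Real.exp (1 / (1 - ‖q‖)) ^ 2 := by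
  rw [linearTerm, norm_mul, norm_mul, norm_pow, sq, mul_assoc]
  gcongr
  · exact norm_qPochInf_le hq (norm_pow_le_one hq _)
  · exact norm_qPochInf_le hq (norm_mul_pow_le_one hq hb n)

lemma norm_squareTerm_le (hq : ‖q‖ < 1) {a : ℂ} (ha : ‖a‖ ≤ 1) (n : ℕ) :
    ‖squareTerm q a n‖ ≤ ‖q‖ ^ n * Real.exp (1 / (1 - ‖q‖)) ^ 4 := by
  rw [squareTerm, norm_mul, norm_mul, norm_mul, norm_pow, norm_pow,
    show Real.exp (1 / (1 - ‖q‖)) ^ 4 = Real.exp (1 / (1 - ‖q‖)) ^ 2 *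
      Real.exp (1 / (1 - ‖q‖)) * Real.exp (1 / (1 - ‖q‖)) by ring, ← mul_assoc, ← mul_assoc]
  gcongr
  · exact norm_qPochInf_le hq (norm_pow_le_one hq _)
  · exact norm_qPochInf_le hq (norm_mul_pow_le_one hq ha n)
  · exact norm_qPoch_le hq (norm_mul_pow_le_one hq ha n) n

lemma summable_norm_pow_mul (hq : ‖q‖ < 1) (M : ℝ) : Summable (fun n : ℕ => ‖q‖ ^ n * M) :=
  (summable_geometric_of_lt_one (norm_nonneg q) hq).mul_right M

lemma summable_linearTerm (hq : ‖q‖ < 1) {b : ℂ} (hb : ‖b‖ ≤ 1) : Summable (linearTerm q b) :=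
  .of_norm_bounded (summable_norm_pow_mul hq _) (norm_linearTerm_le hq hb)

lemma summable_squareTerm (hq : ‖q‖ < 1) {a : ℂ} (ha : ‖a‖ ≤ 1) : Summable (squareTerm q a) :=
  .of_norm_bounded (summable_norm_pow_mul hq _) (norm_squareTerm_le hq ha)

lemma norm_mul_le_one (hq : ‖q‖ < 1) {a : ℂ} (ha : ‖a‖ ≤ 1) : ‖a * q‖ ≤ 1 := by
  simpa using norm_mul_pow_le_one hq ha 1

/-- With x = q^n this is x(1 - bx) + bx = 1 - (1 - x)(1 - bx); the right-hand side telescopes in n.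
-/
lemma linearTerm_add (hq : ‖q‖ < 1) (b : ℂ) (n : ℕ) :
    linearTerm q b n + b * linearTerm q (b * q) n =
      qPochInf (q ^ (n + 1)) q * qPochInf (b * q ^ (n + 1)) q
        - qPochInf (q ^ n) q * qPochInf (b * q ^ n) q := by
  rw [linearTerm, linearTerm, qPochInf_eq_mul hq (q ^ n), qPochInf_eq_mul hq (b * q ^ n),
    show b * q * q ^ n = b * q ^ (n + 1) by ring, show b * q ^ n * q = b * q ^ (n + 1) by ring,
    ← pow_succ]
  ring

lemma tsum_linearTerm_add (hq : ‖q‖ < 1) {b : ℂ} (hb : ‖b‖ ≤ 1) :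
    (∑' n, linearTerm q b n) + b * ∑' n, linearTerm q (b * q) n = 1 := by
  have h := (summable_linearTerm hq hb).hasSum.add
    ((summable_linearTerm hq (norm_mul_le_one hq hb)).hasSum.mul_left b)
  refine tendsto_nhds_unique h.tendsto_sum_nat ?_
  simp only [linearTerm_add hq]
  simp only [Finset.sum_range_sub (fun n => qPochInf (q ^ n) q * qPochInf (b * q ^ n) q),
    pow_zero, qPochInf_one_left hq, zero_mul, sub_zero]
  simpa using (tendsto_qPochInf_one hq (tendsto_pow_atTop_nhds_zero_of_norm_lt_one hq)).mul
    (tendsto_qPochInf_one hq (tendsto_mul_pow_zero hq b))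

lemma squareTerm_zero_eq (hq : ‖q‖ < 1) (a : ℂ) :
    squareTerm q a 0 + (a - 1) * squareTerm q (a * q) 0 = 0 := by
  simp only [squareTerm, pow_zero, mul_one]
  rw [qPochInf_eq_mul hq a]
  simp only [qPoch, Finset.range_zero, Finset.prod_empty]
  ring

/-- After common factors are removed, with x = q^{n+1}, this is (1 - ax)^2 + (a - 1)(1 - ax^2) = a(1
- x)^2. -/
lemma squareTerm_succ_eq (hq : ‖q‖ < 1) (a : ℂ) (n : ℕ) :
    squareTerm q a (n + 1) + (a - 1) * squareTerm q (a * q) (n + 1) =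
      a * q * squareTerm q (a * q * q) n := by
  have h1 : qPoch (a * q ^ (n + 1)) q (n + 1) =
      (1 - a * q ^ (n + 1)) * qPoch (a * q ^ (n + 2)) q n := by
    rw [qPoch_succ']; ring_nf
  have h2 : qPoch (a * q * q ^ (n + 1)) q (n + 1) =
      qPoch (a * q ^ (n + 2)) q n * (1 - a * q ^ (2 * n + 2)) := by
    rw [qPoch_succ]; ring_nf
  have h3 : qPochInf (a * q ^ (n + 1)) q =
      (1 - a * q ^ (n + 1)) * qPochInf (a * q ^ (n + 2)) q := by
    rw [qPochInf_eq_mul hq]; ring_nf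
  have h4 : qPochInf (q ^ (n + 1)) q = (1 - q ^ (n + 1)) * qPochInf (q ^ (n + 2)) q := by
    rw [qPochInf_eq_mul hq]; ring_nf
  simp only [squareTerm]
  rw [h1, h2, h3, h4, show a * q * q ^ (n + 1) = a * q ^ (n + 2) by ring,
    show a * q * q * q ^ n = a * q ^ (n + 2) by ring, show n + 1 + 1 = n + 2 from rfl]
  ring

lemma tsum_squareTerm_recurrence (hq : ‖q‖ < 1) {a : ℂ} (ha : ‖a‖ ≤ 1) :
    (∑' n, squareTerm q a n) + a * ∑' n, squareTerm q (a * q) n =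
      (∑' n, squareTerm q (a * q) n) + a * q * ∑' n, squareTerm q (a * q * q) n := by
  have ha1 := norm_mul_le_one hq ha
  have h := (summable_squareTerm hq ha).hasSum.add
    ((summable_squareTerm hq ha1).hasSum.mul_left (a - 1))
  have h2 := (summable_squareTerm hq (norm_mul_le_one hq ha1)).hasSum.mul_left (a * q)
  have h3 := (hasSum_nat_add_iff' 1).2 h
  simp only [squareTerm_succ_eq hq, Finset.sum_range_one, squareTerm_zero_eq hq, sub_zero] at h3
  linear_combination h3.unique h2

lemma tsum_squareTerm_add (hq : ‖q‖ < 1) {a : ℂ} (ha : ‖a‖ ≤ 1) :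
    (∑' n, squareTerm q a n) + a * ∑' n, squareTerm q (a * q) n = ∑' n, linearTerm q q n := by
  have hiter : ∀ k : ℕ, (∑' n, squareTerm q (a * q ^ k) n) +
      a * q ^ k * ∑' n, squareTerm q (a * q ^ (k + 1)) n =
      (∑' n, squareTerm q a n) + a * ∑' n, squareTerm q (a * q) n := by
    intro k
    induction k with
    | zero => simp
    | succ k ih =>
      rw [← ih]
      have h := tsum_squareTerm_recurrence hq (norm_mul_pow_le_one hq ha k)
      simp only [mul_assoc, ← pow_succ] at h ⊢
      exact h.symm
  -- As the parameter tends to 0, both factors containing it tend to 1, leaving q^n (q^{n+1};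
  -- q)_∞^2, which is `linearTerm q q n`.
  have hlim : Tendsto (fun k : ℕ => ∑' n, squareTerm q (a * q ^ k) n) atTop
      (𝓝 (∑' n, linearTerm q q n)) := by
    refine tendsto_tsum_of_dominated_convergence (summable_norm_pow_mul hq _) (fun n => ?_)
      (Eventually.of_forall fun k n =>
        norm_squareTerm_le hq (norm_mul_pow_le_one hq ha k) n)
    have hz : Tendsto (fun k : ℕ => a * q ^ k * q ^ n) atTop (𝓝 0) := by
      simpa using (tendsto_mul_pow_zero hq a).mul_const (q ^ n)
    have h := ((tendsto_qPochInf_one hq hz).const_mul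
      (q ^ n * qPochInf (q ^ (n + 1)) q ^ 2)).mul (tendsto_qPoch_one hq hz n)
    rw [mul_one, mul_one, sq, ← mul_assoc] at h
    rw [linearTerm, ← pow_succ']
    simpa only [squareTerm, sq, mul_assoc] using h
  have hlim2 := hlim.add ((tendsto_mul_pow_zero hq a).mul (hlim.comp (tendsto_add_atTop_nat 1)))
  simp only [Function.comp_def, hiter, zero_mul, add_zero] at hlim2
  exact tendsto_nhds_unique tendsto_const_nhds hlim2

lemma norm_tsum_le_of_le (hq : ‖q‖ < 1) {f : ℕ → ℂ} {M : ℝ} (hf : ∀ n, ‖f n‖ ≤ ‖q‖ ^ n * M) :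
    ‖∑' n, f n‖ ≤ ∑' n : ℕ, ‖q‖ ^ n * M :=
  tsum_of_norm_bounded (summable_norm_pow_mul hq M).hasSum hf

lemma hasSum_linearTerm (hq : ‖q‖ < 1) {b : ℂ} (hb : ‖b‖ ≤ 1) :
    HasSum (fun n : ℕ => (-1) ^ n * b ^ n * q ^ n.choose 2) (∑' n, linearTerm q b n) := by
  simpa using hasSum_partialTheta_of_recurrence hq (c := 1)
    (g := fun b => ∑' n, linearTerm q b n)
    (fun _ hb => norm_tsum_le_of_le hq (norm_linearTerm_le hq hb))
    (fun _ hb => tsum_linearTerm_add hq hb) hb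

lemma hasSum_squareTerm (hq : ‖q‖ < 1) {a : ℂ} (ha : ‖a‖ ≤ 1) :
    HasSum (fun n : ℕ => (∑' k, linearTerm q q k) * ((-1) ^ n * a ^ n * q ^ n.choose 2))
      (∑' n, squareTerm q a n) :=
  hasSum_partialTheta_of_recurrence hq (g := fun a => ∑' n, squareTerm q a n)
    (fun _ ha => norm_tsum_le_of_le hq (norm_squareTerm_le hq ha))
    (fun _ ha => tsum_squareTerm_add hq ha) ha

end ProductSums

/-! ### The generating function in terms of the false theta function -/

section Theta

variable {q : ℂ}

lemma cTerm_eq_squareTerm (q : ℂ) : cTerm q = squareTerm q 1 := by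
  ext n; simp [cTerm, squareTerm]

lemma summable_cTerm_succ (hq : ‖q‖ < 1) : Summable (fun n => cTerm q (n + 1)) := by
  rw [cTerm_eq_squareTerm, summable_nat_add_iff 1]
  exact summable_squareTerm hq (by simp)

lemma tsum_cTerm_succ (hq : ‖q‖ < 1) :
    ∑' n, cTerm q (n + 1) = ∑' n, squareTerm q 1 n := by
  rw [cTerm_eq_squareTerm, (summable_squareTerm hq (by simp)).tsum_eq_zero_add]
  simp [squareTerm, qPochInf_one_left hq]

/-- The false theta function `∑_{n ≥ 0} (-1)^n q^{n(n+1)/2}`. -/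
noncomputable def falseTheta (q : ℂ) : ℂ := ∑' n : ℕ, (-1) ^ n * q ^ (n + 1).choose 2

lemma choose_two_succ (n : ℕ) : (n + 1).choose 2 = n + n.choose 2 := by
  rw [Nat.choose_succ_succ' n 1, Nat.choose_one_right]

lemma summable_norm_falseTheta (hq : ‖q‖ < 1) :
    Summable (fun n : ℕ => ‖(-1) ^ n * q ^ (n + 1).choose 2‖) := by
  simpa using summable_norm_pow_of_sub_one_le hq (e := fun n => (n + 1).choose 2)
    (fun n => by rw [choose_two_succ]; omega)

lemma tsum_linearTerm_self (hq : ‖q‖ < 1) : ∑' n, linearTerm q q n = falseTheta q := by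
  rw [← (hasSum_linearTerm hq hq.le).tsum_eq, falseTheta]
  refine tsum_congr fun n => ?_
  rw [choose_two_succ, pow_add]; ring

lemma summable_norm_falseTheta_succ (hq : ‖q‖ < 1) :
    Summable (fun n : ℕ => ‖(-1) ^ n * q ^ (n + 2).choose 2‖) := by
  simpa using summable_norm_pow_of_sub_one_le hq (e := fun n => (n + 2).choose 2)
    (fun n => by rw [choose_two_succ]; omega)

lemma tsum_falseTheta_succ (hq : ‖q‖ < 1) :
    ∑' n : ℕ, (-1) ^ n * q ^ (n + 2).choose 2 = 1 - falseTheta q := by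
  rw [falseTheta, (summable_norm_falseTheta hq).of_norm.tsum_eq_zero_add]
  simp [pow_succ, tsum_neg]

lemma tsum_cTerm_succ_eq (hq : ‖q‖ < 1) :
    ∑' n, cTerm q (n + 1) = falseTheta q * (1 - falseTheta q) := by
  rw [tsum_cTerm_succ hq, ← (hasSum_squareTerm hq (a := 1) (by simp)).tsum_eq, tsum_mul_left,
    tsum_linearTerm_self hq]
  congr 1
  have h := (hasSum_linearTerm hq (b := 1) (by simp)).summable
  simp only [one_pow, mul_one] at h ⊢
  rw [h.tsum_eq_zero_add]
  have h2 : ∀ n : ℕ, (-1 : ℂ) ^ (n + 1) * q ^ (n + 1).choose 2 =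
      -((-1) ^ n * q ^ (n + 1).choose 2) := fun n => by ring
  simp [h2, tsum_neg, falseTheta, sub_eq_add_neg]

end Theta

/-! ### Existence and integrality of the coefficients -/

section Coefficients

/-- The exponent of `q` in the `p`-th term of the double series for
`falseTheta q * (1 - falseTheta q)`. -/
def thetaExponent (p : ℕ × ℕ) : ℕ := (p.1 + 1).choose 2 + (p.2 + 2).choose 2

/-- The coefficient of `q^n` in `falseTheta q * (1 - falseTheta q)`. -/
def thetaCoeff (n : ℕ) : ℤ :=
  ∑ p ∈ Finset.range (n + 1) ×ˢ Finset.range (n + 1),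
    if thetaExponent p = n then (-1) ^ (p.1 + p.2) else 0

lemma HasSum.of_forall_eq {ι : Type*} {f g : ι → ℂ} {a : ℂ} (h : HasSum g a)
    (e : ∀ i, f i = g i) : HasSum f a :=
  (funext e : f = g) ▸ h

/-- The exponent dominates both indices, so the finite box in `thetaCoeff` contains the whole fibre.
-/
lemma mem_range_of_thetaExponent_eq {p : ℕ × ℕ} {n : ℕ} (h : thetaExponent p = n) :
    p ∈ Finset.range (n + 1) ×ˢ Finset.range (n + 1) := by
  simp only [thetaExponent, choose_two_succ] at h
  simp only [Finset.mem_product, Finset.mem_range]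
  omega

lemma thetaCoeff_zero : thetaCoeff 0 = 0 := by
  simp [thetaCoeff, thetaExponent]

lemma hasSum_thetaExponent {q : ℂ} (hq : ‖q‖ < 1) :
    HasSum (fun p : ℕ × ℕ => (-1) ^ (p.1 + p.2) * q ^ thetaExponent p)
      (falseTheta q * (1 - falseTheta q)) := by
  have h1 := summable_norm_falseTheta hq
  have h2 := summable_norm_falseTheta_succ hq
  have h := (summable_mul_of_summable_norm h1 h2).hasSum
  rw [← tsum_mul_tsum_of_summable_norm h1 h2, tsum_falseTheta_succ hq] at h
  refine HasSum.of_forall_eq h fun p => ?_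
  simp only [thetaExponent, pow_add]; ring

lemma hasSum_thetaCoeff {q : ℂ} (hq : ‖q‖ < 1) :
    HasSum (fun n : ℕ => (thetaCoeff n : ℂ) * q ^ n) (falseTheta q * (1 - falseTheta q)) := by
  refine HasSum.of_forall_eq ((hasSum_thetaExponent hq).tsum_fiberwise thetaExponent) fun n => ?_
  rw [tsum_subtype (thetaExponent ⁻¹' {n})
    (fun p : ℕ × ℕ => (-1 : ℂ) ^ (p.1 + p.2) * q ^ thetaExponent p),
    tsum_eq_sum (s := Finset.range (n + 1) ×ˢ Finset.range (n + 1))]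
  · simp only [thetaCoeff, Int.cast_sum, Finset.sum_mul]
    refine Finset.sum_congr rfl fun p _ => ?_
    by_cases hp : thetaExponent p = n <;> simp [Set.indicator, hp]
  · intro p hp
    exact Set.indicator_of_notMem (s := thetaExponent ⁻¹' {n})
      (fun h => hp (mem_range_of_thetaExponent_eq h)) _

lemma isCCoeff_thetaCoeff : IsCCoeff (fun n => (thetaCoeff n : ℂ)) := by
  intro q hq
  rw [tsum_cTerm_succ_eq hq]
  simpa [thetaCoeff_zero] using (hasSum_nat_add_iff' 1).2 (hasSum_thetaCoeff hq)

end Coefficients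

/-! ### Squares of series as sums over ordered pairs -/

section SumsOfSquares

lemma summable_mul_shift {t : ℕ → ℂ} (ht : Summable (fun n => ‖t n‖)) :
    Summable (fun p : ℕ × ℕ => t p.1 * t (p.1 + p.2)) :=
  (summable_mul_of_summable_norm ht ht).comp_injective
    (i := fun p : ℕ × ℕ => (p.1, p.1 + p.2)) fun p p' h => by
      simp only [Prod.mk.injEq] at h
      ext <;> omega

/-- The half-planes m ≤ n and m ≥ n carry equal sums by symmetry; together they cover all pairs once
and the diagonal twice. -/
lemma sq_tsum_add_tsum_sq {t : ℕ → ℂ} (ht : Summable (fun n => ‖t n‖)) :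
    (∑' n, t n) ^ 2 + ∑' n, t n ^ 2 = 2 * ∑' p : ℕ × ℕ, t p.1 * t (p.1 + p.2) := by
  set f : ℕ × ℕ → ℂ := fun p => t p.1 * t p.2
  have hs : Summable f := summable_mul_of_summable_norm ht ht
  have hle : ∑' p : ℕ × ℕ, t p.1 * t (p.1 + p.2) = ∑' p, {p | p.1 ≤ p.2}.indicator f p := by
    have hinj : Function.Injective (fun p : ℕ × ℕ => (p.1, p.1 + p.2)) := fun p p' h => by
      simp only [Prod.mk.injEq] at h
      ext <;> omega
    rw [← hinj.tsum_eq (f := {p | p.1 ≤ p.2}.indicator f)]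
    · refine tsum_congr fun p => ?_
      simp [f]
    · intro p hp
      have hp' : p ∈ {p : ℕ × ℕ | p.1 ≤ p.2} := Set.mem_of_indicator_ne_zero hp
      rw [Set.mem_ofPred_eq] at hp'
      exact ⟨(p.1, p.2 - p.1), by ext <;> simp; omega⟩
  have hge : ∑' p, {p : ℕ × ℕ | p.1 ≤ p.2}.indicator f p =
      ∑' p, {p : ℕ × ℕ | p.2 ≤ p.1}.indicator f p := by
    rw [← (Equiv.prodComm ℕ ℕ).tsum_eq]
    refine tsum_congr fun p => ?_
    simp [Set.indicator, f, mul_comm]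
  have hdiag : ∑' n, t n ^ 2 = ∑' p, {p : ℕ × ℕ | p.1 = p.2}.indicator f p := by
    have hinj : Function.Injective (fun n : ℕ => (n, n)) := fun n m h => by simpa using h
    rw [← hinj.tsum_eq (f := {p | p.1 = p.2}.indicator f)]
    · refine tsum_congr fun n => ?_
      simp [f, sq]
    · intro p hp
      have hp' : p ∈ {p : ℕ × ℕ | p.1 = p.2} := Set.mem_of_indicator_ne_zero hp
      rw [Set.mem_ofPred_eq] at hp'
      exact ⟨p.1, by ext <;> simp [hp']⟩
  rw [two_mul]
  nth_rw 2 [hle]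
  rw [hle, hge, hdiag, sq, tsum_mul_tsum_of_summable_norm ht ht]
  nth_rw 1 [← hge]
  rw [← hs.tsum_add (hs.indicator _), ← (hs.indicator _).tsum_add (hs.indicator _)]
  refine tsum_congr fun p => ?_
  rcases lt_trichotomy p.1 p.2 with h | h | h
  · simp [Set.indicator, f, h.le, h.ne, h.not_ge]
  · simp [Set.indicator, f, h]
  · simp [Set.indicator, f, h.le, h.ne', h.not_ge]

lemma tsum_mul_shift_zero_add {t : ℕ → ℂ} (ht : Summable (fun n => ‖t n‖)) :
    ∑' p : ℕ × ℕ, t p.1 * t (p.1 + p.2) =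
      t 0 * (∑' n, t n) + ∑' p : ℕ × ℕ, t (p.1 + 1) * t (p.1 + 1 + p.2) := by
  have hs := summable_mul_shift ht
  have hs' : Summable (fun p : ℕ × ℕ => t (p.1 + 1) * t (p.1 + 1 + p.2)) :=
    hs.comp_injective (i := fun p : ℕ × ℕ => (p.1 + 1, p.2)) fun p p' h => by
      simp only [Prod.mk.injEq] at h
      ext <;> omega
  rw [hs.tsum_prod, hs'.tsum_prod, hs.prod.tsum_eq_zero_add]
  simp [tsum_mul_left]

end SumsOfSquares

/-! ### Passage to odd squares via q ↦ q^8 -/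

section OddSquares

variable {q : ℂ}

/-- The summand `(-1)^n q^{(2n+1)²}`. -/
noncomputable def oddSquareTerm (q : ℂ) (n : ℕ) : ℂ := (-1) ^ n * q ^ (2 * n + 1) ^ 2

lemma odd_sq_eq (n : ℕ) : (2 * n + 1) ^ 2 = 8 * (n + 1).choose 2 + 1 := by
  induction n with
  | zero => simp
  | succ n ih => rw [choose_two_succ]; linarith

lemma oddSquareTerm_eq (q : ℂ) (n : ℕ) :
    oddSquareTerm q n = q * ((-1) ^ n * (q ^ 8) ^ (n + 1).choose 2) := by
  rw [oddSquareTerm, odd_sq_eq, pow_succ, pow_mul]; ring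

lemma norm_pow_eight_lt_one (hq : ‖q‖ < 1) : ‖q ^ 8‖ < 1 := by
  rw [norm_pow]; exact pow_lt_one₀ (norm_nonneg q) hq (by norm_num)

lemma summable_norm_oddSquareTerm (hq : ‖q‖ < 1) :
    Summable (fun n => ‖oddSquareTerm q n‖) := by
  simp only [oddSquareTerm_eq, norm_mul q]
  exact (summable_norm_falseTheta (norm_pow_eight_lt_one hq)).mul_left _

lemma tsum_oddSquareTerm (q : ℂ) : ∑' n, oddSquareTerm q n = q * falseTheta (q ^ 8) := by
  simp only [oddSquareTerm_eq, tsum_mul_left, falseTheta]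

lemma neg_one_pow_mul_pow_two_squares (q : ℂ) (p : ℕ × ℕ) :
    (-1 : ℂ) ^ (p.2 + 1) * q ^ ((2 * p.1 + 3) ^ 2 + (2 * p.1 + 3 + 2 * p.2) ^ 2) =
      -(oddSquareTerm q (p.1 + 1) * oddSquareTerm q (p.1 + 1 + p.2)) := by
  have h : ((-1 : ℂ) ^ (p.1 + 1)) * (-1) ^ (p.1 + 1) = 1 := by rw [← mul_pow]; simp
  simp only [oddSquareTerm]
  rw [pow_add q, pow_add (-1 : ℂ) (p.1 + 1) p.2,
    show 2 * (p.1 + 1) + 1 = 2 * p.1 + 3 by ring,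
    show 2 * (p.1 + 1 + p.2) + 1 = 2 * p.1 + 3 + 2 * p.2 by ring]
  linear_combination ((-1) ^ p.2 * q ^ (2 * p.1 + 3) ^ 2 * q ^ (2 * p.1 + 3 + 2 * p.2) ^ 2) * h

lemma neg_one_pow_mul_pow_one_add_square (q : ℂ) (n : ℕ) :
    (-1 : ℂ) ^ (n + 1) * q ^ (1 + (2 * n + 1) ^ 2) = -q * oddSquareTerm q n := by
  rw [oddSquareTerm, pow_add q]; ring

lemma pow_two_mul_square (q : ℂ) (n : ℕ) :
    q ^ (2 * (2 * n + 1) ^ 2) = oddSquareTerm q n ^ 2 := by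
  rw [oddSquareTerm, mul_pow, ← pow_mul, ← pow_mul, mul_comm n 2, pow_mul (-1 : ℂ)]
  simp [mul_comm]

lemma summable_oddSquareTerm_sq (hq : ‖q‖ < 1) :
    Summable (fun n => oddSquareTerm q n ^ 2) := by
  have h := summable_norm_oddSquareTerm hq
  simpa [Function.comp_def, sq] using (summable_mul_of_summable_norm h h).comp_injective
    (i := fun n : ℕ => (n, n)) fun n m h => by simpa using h

lemma summable_oddSquareTerm_shift (hq : ‖q‖ < 1) :
    Summable (fun p : ℕ × ℕ => oddSquareTerm q (p.1 + 1) * oddSquareTerm q (p.1 + 1 + p.2)) :=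
  (summable_mul_shift (summable_norm_oddSquareTerm hq)).comp_injective
    (i := fun p : ℕ × ℕ => (p.1 + 1, p.2)) fun p p' h => by
      simp only [Prod.mk.injEq] at h
      ext <;> omega

lemma two_squares_sum_eq (hq : ‖q‖ < 1) :
    2 * (∑' p : ℕ × ℕ,
        (-1 : ℂ) ^ (p.2 + 1) * q ^ ((2 * p.1 + 3) ^ 2 + (2 * p.1 + 3 + 2 * p.2) ^ 2))
      + (∑' n : ℕ, (-1 : ℂ) ^ (n + 1) * q ^ (1 + (2 * n + 1) ^ 2))
      + ∑' n : ℕ, q ^ (2 * (2 * n + 1) ^ 2)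
      = q ^ 2 * (falseTheta (q ^ 8) * (1 - falseTheta (q ^ 8))) := by
  have ht := summable_norm_oddSquareTerm hq
  have h1 := sq_tsum_add_tsum_sq ht
  rw [tsum_mul_shift_zero_add ht, tsum_oddSquareTerm,
    show oddSquareTerm q 0 = q by simp [oddSquareTerm]] at h1
  simp only [neg_one_pow_mul_pow_two_squares, neg_one_pow_mul_pow_one_add_square,
    pow_two_mul_square, tsum_neg, tsum_mul_left, tsum_oddSquareTerm]
  linear_combination h1

end OddSquares

theorem theorem5 :
    -- the infinite products and the series defining the generating function converge
    (∀ q : ℂ, ‖q‖ < 1 →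
      (∀ n : ℕ, 1 ≤ n → Multipliable (fun j : ℕ => 1 - q ^ n * q ^ j)) ∧
      Summable (fun n : ℕ => cTerm q (n + 1))) ∧
    -- the coefficients exist and are integers
    (∃ C : ℕ → ℤ, IsCCoeff (fun n => (C n : ℂ))) ∧
    -- the identity
    (∀ C : ℕ → ℂ, IsCCoeff C → ∀ q : ℂ, ‖q‖ < 1 →
      Summable (fun p : ℕ × ℕ =>
        (-1 : ℂ) ^ (p.2 + 1) * q ^ ((2 * p.1 + 3) ^ 2 + (2 * p.1 + 3 + 2 * p.2) ^ 2)) ∧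
      Summable (fun n : ℕ => (-1 : ℂ) ^ (n + 1) * q ^ (1 + (2 * n + 1) ^ 2)) ∧
      Summable (fun n : ℕ => q ^ (2 * (2 * n + 1) ^ 2)) ∧
      HasSum (fun n : ℕ => C (n + 1) * q ^ (8 * (n + 1) + 2))
        (2 * (∑' p : ℕ × ℕ,
            (-1 : ℂ) ^ (p.2 + 1) * q ^ ((2 * p.1 + 3) ^ 2 + (2 * p.1 + 3 + 2 * p.2) ^ 2))
          + (∑' n : ℕ, (-1 : ℂ) ^ (n + 1) * q ^ (1 + (2 * n + 1) ^ 2))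
          + ∑' n : ℕ, q ^ (2 * (2 * n + 1) ^ 2))) := by
  refine ⟨fun q hq => ⟨fun n _ => multipliable_qPochInf hq _, summable_cTerm_succ hq⟩,
    ⟨thetaCoeff, isCCoeff_thetaCoeff⟩, fun C hC q hq => ⟨?_, ?_, ?_, ?_⟩⟩
  · simpa only [neg_one_pow_mul_pow_two_squares] using (summable_oddSquareTerm_shift hq).neg
  · simpa only [neg_one_pow_mul_pow_one_add_square] using
      (summable_norm_oddSquareTerm hq).of_norm.mul_left (-q)
  · simpa only [pow_two_mul_square] using summable_oddSquareTerm_sq hq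
  -- Evaluating the defining property of C at q^8 suffices, so uniqueness of the coefficients is not
  -- needed.
  · have h := (hC (q ^ 8) (norm_pow_eight_lt_one hq)).mul_left (q ^ 2)
    rw [tsum_cTerm_succ_eq (norm_pow_eight_lt_one hq)] at h
    rw [two_squares_sum_eq hq]
    refine HasSum.of_forall_eq h fun n => ?_
    rw [pow_add q, pow_mul]; ring
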